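/- Let $G$ be a finite simple graph and $f:V(G)\to\mathbb{N}$. The on-line $f$-list coloring game on $G$ is played by Alice and Bob as follows. Initially all vertices are uncolored. In the $i$th round Alice marks a nonempty set $V_i$ of uncolored vertices, giving every vertex of $V_i$ the permissible color $i$; then Bob chooses an independent set $X_i\subseteq V_i$ of $G$ and colors all its vertices with color $i$. Alice wins if at some moment there is an uncolored vertex $v$ that has been marked $f(v)$ times; otherwise Bob wins. The on-line choice number $\chi_p(G)$ is the least $k\in\mathbb{N}$ such that Bob has a winning strategy in this game for the constant function $f\equiv k$. Let $K_{m\star k}$ denote the complete multipartite graph with exactly $k$ parts, each of size $m$. For all integers $m\ge 3$ and $k\ge 0$, $$\chi_p(K_{m\star k})\;\le\;\Bigl(m+\tfrac12-\sqrt{2m-2}\Bigr)\,k .$$ In particular (the case $m=3$), $\chi_p(K_{3\star k})\le \tfrac32\,k$ for all $k\ge 0$. -/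

import Mathlib

/-! The on-line list coloring game (Alice marks, Bob colors) on a finite graph.

A history of the game is the list of the sets that Alice has marked, most recent round first.
A strategy of Bob is a function `σ` which, from the history up to and including Alice's current
mark, gives the set of vertices that Bob colors in the current round. -/

namespace OnlineColoring

variable {V : Type*} [DecidableEq V]

/-- The set of vertices that are colored after the rounds in the history, if Bob follows `σ`. -/
def colored (σ : List (Finset V) → Finset V) : List (Finset V) → Finset V
  | [] => ∅
  | A :: h => colored σ h ∪ σ (A :: h)

/-- The history is a legal play of Alice against `σ`: in every round she marks a nonempty set of
vertices that are still uncolored. -/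
def IsPlay (σ : List (Finset V) → Finset V) : List (Finset V) → Prop
  | [] => True
  | A :: h => IsPlay σ h ∧ A.Nonempty ∧ Disjoint A (colored σ h)

/-- The number of rounds of the history in which `v` is marked, that is, the number of permissible
colors that `v` has been assigned. -/
def timesMarked (v : V) (h : List (Finset V)) : ℕ :=
  h.countP (fun A => decide (v ∈ A))

/-- `σ` is a winning strategy of Bob in the on-line `f`-list coloring game on `G`. -/
structure IsWinningStrategy (G : SimpleGraph V) (f : V → ℕ)
    (σ : List (Finset V) → Finset V) : Prop where
  /-- In every round Bob colors an independent subset of the marked set. -/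
  legal : ∀ (A : Finset V) (h : List (Finset V)), IsPlay σ (A :: h) →
    σ (A :: h) ⊆ A ∧ G.IsIndepSet (σ (A :: h) : Set V)
  /-- At no time is there an uncolored vertex `v` that has been marked `f v` times. -/
  wins : ∀ h : List (Finset V), IsPlay σ h → ∀ v : V, v ∉ colored σ h → timesMarked v h < f v

/-- `G` is on-line `f`-choosable: Bob has a winning strategy. -/
def OnlineChoosable (G : SimpleGraph V) (f : V → ℕ) : Prop :=
  ∃ σ : List (Finset V) → Finset V, IsWinningStrategy G f σ

/-- The on-line choice number: the least `k` such that `G` is on-line `k`-choosable. For a finite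
graph such a `k` exists, see `onlineChoosable_card`. -/
noncomputable def onlineChoiceNumber (G : SimpleGraph V) : ℕ :=
  sInf {k : ℕ | OnlineChoosable G (fun _ => k)}

/-- A finite graph is on-line `|V|`-choosable, so that the minimum which defines the on-line choice
number is over a nonempty set. -/
theorem onlineChoosable_card [Fintype V] (G : SimpleGraph V) :
    OnlineChoosable G (fun _ => Fintype.card V) := by
  classical
  let pick : Finset V → Finset V := fun A => if hA : A.Nonempty then {hA.choose} else ∅
  have pick_sub : ∀ A : Finset V, pick A ⊆ A := by
    intro A
    by_cases hA : A.Nonempty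
    · simp only [pick, hA, dif_pos, Finset.singleton_subset_iff]
      exact hA.choose_spec
    · simp [pick, hA]
  have pick_card : ∀ A : Finset V, A.Nonempty → (pick A).card = 1 := by
    intro A hA
    simp [pick, hA]
  let σ : List (Finset V) → Finset V := fun h => pick (h.headD ∅)
  have hσ : ∀ A h, σ (A :: h) = pick A := fun A h => rfl
  refine ⟨σ, ⟨fun A h _ => ⟨?_, ?_⟩, ?_⟩⟩
  · rw [hσ]
    exact pick_sub A
  · rw [hσ]
    by_cases hA : A.Nonempty
    · simp [pick, hA, SimpleGraph.IsIndepSet]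
    · simp [pick, hA, SimpleGraph.IsIndepSet]
  · have key : ∀ h, IsPlay σ h → (colored σ h).card = h.length := by
      intro h
      induction h with
      | nil => intro _; simp [colored]
      | cons A h ih =>
        rintro ⟨h1, h2, h3⟩
        have hd : Disjoint (colored σ h) (σ (A :: h)) := by
          rw [hσ]
          exact (h3.mono_left (pick_sub A)).symm
        rw [colored, Finset.card_union_of_disjoint hd, ih h1, hσ, pick_card A h2,
          List.length_cons]
    intro h hp v hv
    have h1 : timesMarked v h ≤ h.length := List.countP_le_length
    have h2 : (colored σ h).card < Fintype.card V :=
      Finset.card_lt_univ_of_notMem hv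
    have h3 := key h hp
    show timesMarked v h < Fintype.card V
    omega

end OnlineColoring

/-! In each round Bob picks one part and colors all its marked vertices, so only the choice of the
part matters. A part is active at first; it may be retired, with a type and a rank that place it in
a fixed order of precedence. The potential `Inv` asks that every `s`-subset of an active part has
total budget at least `demand`, up to a small `allowance`, and that every vertex of a retired part
can afford all `load` that may be served before it. All remaining budgets are then positive, so Bob
wins if `Inv` survives every mark.

Survival has three cases. If a marked set meets its demand exactly, its part must be colored; a
largest such set, of size `t`, is chosen and the rest of its part retires with type `t`. Otherwise
only sets that are not tight lose budget, which spares one unit, and Bob serves either the foremost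
marked retired part or the active part with the most marks, by comparing types with the number of
marks. `partWeight` is shaped so that the demand drops enough in each case.

At the start, `k` parts of size `m` need `k * partWeight s m ≤ s * B` up to the allowance. Here
`partWeight s m / s = m + 1/2 - ((m - 1)/s + s/2)`, and AM-GM bounds the bracket below by `√(2m -
2)`. -/

namespace OnlineColoring

set_option linter.unusedSectionVars false

/-! ### Arithmetic of the weights -/

/-- The marking budget that a part of size `q` contributes to the requirement on a set of `s`
vertices of one part. -/
def partWeight (s q : ℕ) : ℤ :=
  1 + ∑ a ∈ Finset.Ico 1 s, max ((q : ℤ) - a) 1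

theorem partWeight_one (q : ℕ) : partWeight 1 q = 1 := by simp [partWeight]

theorem partWeight_succ {s : ℕ} (hs : 1 ≤ s) (q : ℕ) :
    partWeight (s + 1) q = partWeight s q + max ((q : ℤ) - s) 1 := by
  simp only [partWeight, Finset.sum_Ico_succ_top hs]
  ring

theorem two_mul_partWeight_of_le {s q : ℕ} (hs : 1 ≤ s) (h : s ≤ q) :
    2 * partWeight s q = 2 * ((s : ℤ) - 1) * q + 2 - s * (s - 1) := by
  induction s, hs using Nat.le_induction with
  | base => simp [partWeight_one]
  | succ s hs ih =>
    rw [partWeight_succ hs, mul_add, ih (by omega), max_eq_left (by omega)]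
    push_cast
    ring

theorem two_mul_partWeight_of_ge {s q : ℕ} (hq : 1 ≤ q) (h : q ≤ s) :
    2 * partWeight s q = (q : ℤ) * (q - 1) + 2 + 2 * (s - q) := by
  induction s, h using Nat.le_induction with
  | base => rw [two_mul_partWeight_of_le hq le_rfl]; ring
  | succ s hs ih =>
    rw [partWeight_succ (by omega), mul_add, ih, max_eq_right (by omega)]
    push_cast
    ring

/-- The drop in demand when a part with `x` marks retires with type `t`: for `s ≤ t` it pays for an
`s`-set even if all its vertices are marked. -/
theorem le_partWeight_sub_of_le {s t x q : ℕ} (hs : 1 ≤ s) (hst : s ≤ t) (htx : t ≤ x)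
    (hxq : x ≤ q) :
    (s : ℤ) ≤ partWeight s q - min ((s : ℤ) - 1) t * (q - x : ℤ) := by
  have h := two_mul_partWeight_of_le hs (by omega : s ≤ q)
  rw [min_eq_left (by omega)]
  rcases hs.eq_or_lt with rfl | hs'
  · push_cast at *; linarith
  have h1 : (0 : ℤ) ≤ ((s : ℤ) - 1) * (2 * x - s - 2) := by
    apply mul_nonneg <;> omega
  nlinarith

/-- For `s > t` the drop may be one short of `s`; this is enough because such sets are not tight
when `t` is the largest tight size. -/
theorem le_partWeight_sub_of_lt {s t x q : ℕ} (ht : 1 ≤ t) (hst : t < s) (htx : t ≤ x)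
    (hxq : x ≤ q) (hq : 2 ≤ q) :
    (s : ℤ) - 1 ≤ partWeight s q - min ((s : ℤ) - 1) t * (q - x : ℤ) := by
  rw [min_eq_right (by omega)]
  have hx : (0 : ℤ) ≤ t * ((x : ℤ) - t) := by
    apply mul_nonneg <;> omega
  rcases le_total s q with h | h
  · have h1 := two_mul_partWeight_of_le (by omega) h
    have h2 : (0 : ℤ) ≤ ((s : ℤ) - 1 - t) * (q - s) := by apply mul_nonneg <;> omega
    have h3 : (0 : ℤ) ≤ ((s : ℤ) - 1 - t) * (s - 2 - t) := by
      rcases (by omega : s = t + 1 ∨ t + 2 ≤ s) with rfl | h'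
      · simp
      · apply mul_nonneg <;> omega
    have h4 : (0 : ℤ) ≤ ((t : ℤ) - 1) * (t - 2) := by
      rcases ht.eq_or_lt with rfl | h'
      · simp
      · apply mul_nonneg <;> omega
    nlinarith
  · have h1 := two_mul_partWeight_of_ge (by omega) h
    -- The bound `t * (q - t) ≤ q² / 4` leaves a surplus of `(q - 2) * (q - 4) / 4`, negative only
    -- at `q = 3`, where integrality of `t` is needed.
    rcases (by omega : q = 2 ∨ q = 3 ∨ 4 ≤ q) with rfl | rfl | h'
    · have : t = 1 ∨ t = 2 := by omega
      rcases this with rfl | rfl <;> push_cast at * <;> linarith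
    · have : t = 1 ∨ t = 2 ∨ t = 3 := by omega
      rcases this with rfl | rfl | rfl <;> push_cast at * <;> linarith
    · have h2 : (0 : ℤ) ≤ ((q : ℤ) - 2) * (q - 4) := by apply mul_nonneg <;> omega
      nlinarith [sq_nonneg ((q : ℤ) - 2 * t)]

theorem partWeight_succ_right_ge {s q : ℕ} (hs : 2 ≤ s) (hq : 2 ≤ q) :
    partWeight s q + 1 ≤ partWeight s (q + 1) := by
  rcases le_total s q with h | h
  · have h1 := two_mul_partWeight_of_le (by omega) h
    have h2 := two_mul_partWeight_of_le (q := q + 1) (by omega : 1 ≤ s) (by omega)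
    push_cast at *
    nlinarith
  · rcases h.eq_or_lt with rfl | h
    · have h1 := two_mul_partWeight_of_le (by omega : 1 ≤ q) le_rfl
      have h2 := two_mul_partWeight_of_le (q := q + 1) (by omega : 1 ≤ q) (by omega)
      push_cast at *
      nlinarith
    · have h1 := two_mul_partWeight_of_ge (by omega : 1 ≤ q) h.le
      have h2 := two_mul_partWeight_of_ge (q := q + 1) (by omega) (by omega : q + 1 ≤ s)
      push_cast at *
      nlinarith

theorem add_le_partWeight_add {s q : ℕ} (hs : 2 ≤ s) (hq : 2 ≤ q) (x : ℕ) :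
    partWeight s q + x ≤ partWeight s (q + x) := by
  induction x with
  | zero => simp
  | succ x ih =>
    have := partWeight_succ_right_ge hs (by omega : 2 ≤ q + x)
    rw [← add_assoc]
    push_cast
    linarith

theorem add_mul_le_partWeight_add {s q : ℕ} (hs : 1 ≤ s) (h : s ≤ q) (x : ℕ) :
    partWeight s q + ((s : ℤ) - 1) * x = partWeight s (q + x) := by
  have h1 := two_mul_partWeight_of_le hs h
  have h2 := two_mul_partWeight_of_le hs (by omega : s ≤ q + x)
  push_cast at *
  linarith

theorem add_le_partWeight {s q : ℕ} (hs : 2 ≤ s) (hq : 2 ≤ q) :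
    (s : ℤ) - 1 + (q - 1) ≤ partWeight s q := by
  have h1 := two_mul_partWeight_of_ge (by omega : 1 ≤ 2) hs
  have h2 := add_le_partWeight_add hs le_rfl (q - 2)
  rw [show 2 + (q - 2) = q by omega, Nat.cast_sub hq] at h2
  push_cast at *
  linarith

/-! ### From an invariant to a winning strategy -/

/-- If the positions from a set `P` of good positions (uncolored vertices with their remaining
budgets) can be maintained against every mark, then Bob wins. -/
theorem onlineChoosable_of_invariant {V : Type*} [DecidableEq V] [Fintype V] (G : SimpleGraph V)
    (f : V → ℕ) (P : Finset V → (V → ℤ) → Prop)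
    (hpos : ∀ A b, P A b → ∀ v ∈ A, 0 < b v)
    (hstep : ∀ A b, P A b → ∀ M ⊆ A, M.Nonempty → ∃ X ⊆ M, G.IsIndepSet (X : Set V) ∧
      P (A \ X) (fun v => b v - if v ∈ M then 1 else 0))
    (hinit : P Finset.univ (fun v => f v)) :
    OnlineChoosable G f := by
  classical
  have hex : ∀ A b M, ∃ X, P A b → M ⊆ A → M.Nonempty → X ⊆ M ∧ G.IsIndepSet (X : Set V) ∧
      P (A \ X) (fun v => b v - if v ∈ M then 1 else 0) := by
    intro A b M
    by_cases h : P A b ∧ M ⊆ A ∧ M.Nonempty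
    · obtain ⟨X, hX⟩ := hstep A b h.1 M h.2.1 h.2.2
      exact ⟨X, fun _ _ _ => hX⟩
    · exact ⟨∅, fun h1 h2 h3 => absurd ⟨h1, h2, h3⟩ h⟩
  choose pick hpick using hex
  -- `C` is the colored set computed from `pick` alone, so that `σ` can be defined without
  -- circularity.
  let C : List (Finset V) → Finset V := fun h => List.rec ∅
    (fun M h c => c ∪ pick (Finset.univ \ c) (fun v => (f v : ℤ) - timesMarked v h) M) h
  let σ : List (Finset V) → Finset V := fun h => match h with
    | [] => ∅
    | M :: h => pick (Finset.univ \ C h) (fun v => (f v : ℤ) - timesMarked v h) M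
  have hC : ∀ h, colored σ h = C h := by
    intro h
    induction h with
    | nil => rfl
    | cons M h ih => rw [colored, ih]
  have hP : ∀ h, IsPlay σ h →
      P (Finset.univ \ C h) (fun v => (f v : ℤ) - timesMarked v h) := by
    intro h
    induction h with
    | nil =>
      intro _
      simpa [C, timesMarked] using hinit
    | cons M h ih =>
      rintro ⟨h1, h2, h3⟩
      rw [hC] at h3
      have := (hpick _ _ M (ih h1) (by
        intro v hv
        simpa using Finset.disjoint_left.1 h3 hv) h2).2.2
      convert this using 1
      · change Finset.univ \ (C h ∪ _) = _
        rw [sdiff_sdiff_left]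
        rfl
      · funext v
        simp only [timesMarked, List.countP_cons]
        split_ifs <;> (simp_all; try ring)
  refine ⟨σ, ⟨?_, ?_⟩⟩
  · rintro M h ⟨h1, h2, h3⟩
    rw [hC] at h3
    have := hpick _ _ M (hP h h1) (by
      intro v hv
      simpa using Finset.disjoint_left.1 h3 hv) h2
    exact ⟨this.1, this.2.1⟩
  · intro h hp v hv
    rw [hC] at hv
    have : 0 < (f v : ℤ) - timesMarked v h := hpos _ _ (hP h hp) v (by simpa using hv)
    omega

/-! ### Statuses of parts and the invariant -/

/-- Bob's bookkeeping for a part: `none` if the part is active, and `some (r, o)` if it has been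
retired with type `r` and rank `o`. -/
abbrev PartStatus := Option (ℕ × ℤ)

/-- The contribution of a part with `q` uncolored vertices to the demand on `s`-sets. -/
def PartStatus.weight (s : ℕ) : PartStatus → ℕ → ℤ
  | none, q => partWeight s q
  | some p, q => min ((s : ℤ) - 1) p.1 * q

/-- The contribution of a part with `q` uncolored vertices to the demand on the vertices of a
retired part with data `p`. Retired parts of higher type, and those of the same type and lower rank,
have precedence. -/
def PartStatus.load (p : ℕ × ℤ) : PartStatus → ℕ → ℤ
  | none, q => max ((q : ℤ) - p.1) 1
  | some p', q => if p.1 < p'.1 ∨ p.1 = p'.1 ∧ p'.2 < p.2 then q else 0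

theorem PartStatus.weight_none (s q : ℕ) : PartStatus.weight s none q = partWeight s q := rfl

theorem PartStatus.weight_some (s : ℕ) (p : ℕ × ℤ) (q : ℕ) :
    PartStatus.weight s (some p) q = min ((s : ℤ) - 1) p.1 * q := rfl

theorem PartStatus.load_none (p : ℕ × ℤ) (q : ℕ) :
    PartStatus.load p none q = max ((q : ℤ) - p.1) 1 := rfl

theorem PartStatus.load_some (p p' : ℕ × ℤ) (q : ℕ) :
    PartStatus.load p (some p') q =
      if p.1 < p'.1 ∨ p.1 = p'.1 ∧ p'.2 < p.2 then (q : ℤ) else 0 := rfl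

/-- The amount by which an `s`-subset of an active part with `q` uncolored vertices may fall short
of the demand. -/
def allowance (s q : ℕ) : ℤ := min ((s : ℤ) - 1) ((q : ℤ) - 2)

variable {V ι : Type*} [DecidableEq V] [DecidableEq ι]

/-- The vertices of `A` in the part `i`. -/
def partIn (π : V → ι) (A : Finset V) (i : ι) : Finset V := A.filter (fun v => π v = i)

theorem mem_partIn {π : V → ι} {A : Finset V} {i : ι} {v : V} :
    v ∈ partIn π A i ↔ v ∈ A ∧ π v = i := Finset.mem_filter

theorem partIn_sdiff_partIn_self (π : V → ι) (A M : Finset V) (i : ι) :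
    partIn π (A \ partIn π M i) i = partIn π (A \ M) i := by
  ext v
  simp only [mem_partIn, Finset.mem_sdiff]
  tauto

theorem partIn_sdiff_partIn_of_ne {π : V → ι} (A M : Finset V) {i j : ι} (h : i ≠ j) :
    partIn π (A \ partIn π M j) i = partIn π A i := by
  ext v
  simp only [mem_partIn, Finset.mem_sdiff]
  constructor
  · tauto
  · rintro ⟨h1, rfl⟩
    tauto

theorem card_partIn_sdiff (π : V → ι) {A M : Finset V} (h : M ⊆ A) (i : ι) :
    (partIn π (A \ M) i).card + (partIn π M i).card = (partIn π A i).card := by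
  rw [← Finset.card_union_of_disjoint]
  · congr 1
    ext v
    simp only [mem_partIn, Finset.mem_sdiff, Finset.mem_union]
    have := @h v
    tauto
  · rw [Finset.disjoint_left]
    intro v
    simp only [mem_partIn, Finset.mem_sdiff]
    tauto

theorem sum_sub_ite_mem (U M : Finset V) (b : V → ℤ) :
    ∑ v ∈ U, (b v - if v ∈ M then 1 else 0) = ∑ v ∈ U, b v - (U ∩ M).card := by
  rw [Finset.sum_sub_distrib, Finset.sum_boole, Finset.filter_mem_eq_inter]

variable [Fintype ι]

/-- The demand on the `s`-subsets of active parts. -/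
def demand (π : V → ι) (A : Finset V) (D : ι → PartStatus) (s : ℕ) : ℤ :=
  ∑ i, (D i).weight s (partIn π A i).card

/-- The invariant that Bob maintains: `A` is the set of uncolored vertices, `b` gives their
remaining budgets, and `N` bounds the sizes of the parts. -/
structure Inv (N : ℕ) (π : V → ι) (A : Finset V) (b : V → ℤ) (D : ι → PartStatus) : Prop where
  card_le : ∀ i, (partIn π A i).card ≤ N
  two_le : ∀ i, D i = none → 2 ≤ (partIn π A i).card
  type_le : ∀ i p, D i = some p → p.1 ≤ N
  inj : ∀ i j p, D i = some p → D j = some p → i = j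
  active : ∀ i, D i = none → ∀ U ⊆ partIn π A i, U.Nonempty →
    demand π A D U.card ≤ ∑ v ∈ U, b v + allowance U.card (partIn π A i).card
  retired : ∀ v ∈ A, ∀ p, D (π v) = some p →
    1 + ∑ i, (D i).load p (partIn π A i).card ≤ b v

theorem sum_update_sdiff (F : PartStatus → ℕ → ℤ) (π : V → ι) (A M : Finset V)
    (D : ι → PartStatus) (j : ι) (d : PartStatus) :
    ∑ i, F (Function.update D j d i) (partIn π (A \ partIn π M j) i).card =
      ∑ i ∈ Finset.univ.erase j, F (D i) (partIn π A i).card +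
        F d (partIn π (A \ M) j).card := by
  rw [← Finset.sum_erase_add _ _ (Finset.mem_univ j), Function.update_self,
    partIn_sdiff_partIn_self]
  congr 1
  apply Finset.sum_congr rfl
  intro i hi
  rw [Function.update_of_ne (Finset.ne_of_mem_erase hi),
    partIn_sdiff_partIn_of_ne _ _ (Finset.ne_of_mem_erase hi)]

theorem sum_erase_partIn (F : PartStatus → ℕ → ℤ) (π : V → ι) (A : Finset V)
    (D : ι → PartStatus) (j : ι) :
    ∑ i ∈ Finset.univ.erase j, F (D i) (partIn π A i).card =
      ∑ i, F (D i) (partIn π A i).card - F (D j) (partIn π A j).card := by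
  rw [← Finset.sum_erase_add _ _ (Finset.mem_univ j)]
  ring

/-- Bob colors the marked vertices of the part `j`, which gets the status `d`. -/
theorem Inv.update {N : ℕ} {π : V → ι} {A : Finset V} {b : V → ℤ} {D : ι → PartStatus}
    (h : Inv N π A b D) {M : Finset V} (j : ι) (d : PartStatus)
    (two_le : d = none → 2 ≤ (partIn π (A \ M) j).card)
    (type_le : ∀ p, d = some p → p.1 ≤ N)
    (inj : ∀ p, d = some p → ∀ i ≠ j, D i ≠ some p)
    (active : ∀ i ≠ j, D i = none → ∀ U ⊆ partIn π A i, U.Nonempty →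
      demand π A D U.card + d.weight U.card (partIn π (A \ M) j).card ≤
        (D j).weight U.card (partIn π A j).card + ∑ v ∈ U, b v - (U ∩ M).card +
          allowance U.card (partIn π A i).card)
    (active_self : d = none → ∀ U ⊆ partIn π (A \ M) j, U.Nonempty →
      demand π A D U.card + d.weight U.card (partIn π (A \ M) j).card ≤
        (D j).weight U.card (partIn π A j).card + ∑ v ∈ U, b v +
          allowance U.card (partIn π (A \ M) j).card)
    (retired : ∀ v ∈ A, π v ≠ j → ∀ p, D (π v) = some p →
      1 + ∑ i, (D i).load p (partIn π A i).card + d.load p (partIn π (A \ M) j).card ≤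
        (D j).load p (partIn π A j).card + b v - if v ∈ M then 1 else 0)
    (retired_self : ∀ p, d = some p → ∀ v ∈ partIn π (A \ M) j,
      1 + ∑ i ∈ Finset.univ.erase j, (D i).load p (partIn π A i).card ≤ b v) :
    Inv N π (A \ partIn π M j) (fun v => b v - if v ∈ M then 1 else 0)
      (Function.update D j d) := by
  have hdem : ∀ s, demand π (A \ partIn π M j) (Function.update D j d) s =
      demand π A D s - (D j).weight s (partIn π A j).card +
        d.weight s (partIn π (A \ M) j).card := by
    intro s
    rw [demand, demand, sum_update_sdiff (PartStatus.weight s),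
      sum_erase_partIn (PartStatus.weight s)]
  refine ⟨?_, ?_, ?_, ?_, ?_, ?_⟩
  · intro i
    refine (Finset.card_le_card ?_).trans (h.card_le i)
    exact Finset.filter_subset_filter _ Finset.sdiff_subset
  · intro i hi
    rcases eq_or_ne i j with rfl | hij
    · rw [partIn_sdiff_partIn_self]
      exact two_le (by simpa using hi)
    · rw [partIn_sdiff_partIn_of_ne _ _ hij]
      exact h.two_le i (by simpa [hij] using hi)
  · intro i p hi
    rcases eq_or_ne i j with rfl | hij
    · exact type_le p (by simpa using hi)
    · exact h.type_le i p (by simpa [hij] using hi)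
  · intro i i' p hi hi'
    rcases eq_or_ne i j with rfl | hij <;> rcases eq_or_ne i' i with rfl | hij'
    · rfl
    · exact absurd (by simpa [hij'] using hi') (inj p (by simpa using hi) i' hij')
    · rfl
    · rcases eq_or_ne i' j with rfl | hj
      · exact absurd (by simpa [hij] using hi) (inj p (by simpa using hi') i hij)
      · exact h.inj i i' p (by simpa [hij] using hi) (by simpa [hj] using hi')
  · intro i hi U hU hne
    rw [hdem, sum_sub_ite_mem]
    rcases eq_or_ne i j with rfl | hij
    · rw [partIn_sdiff_partIn_self] at hU ⊢
      have h1 := active_self (by simpa using hi) U hU hne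
      have h2 : U ∩ M = ∅ := by
        rw [← Finset.disjoint_iff_inter_eq_empty, Finset.disjoint_left]
        intro v hv
        have := hU hv
        simp only [mem_partIn, Finset.mem_sdiff] at this
        exact this.1.2
      rw [h2]
      simp only [Finset.card_empty, Nat.cast_zero]
      linarith
    · rw [partIn_sdiff_partIn_of_ne _ _ hij] at hU ⊢
      have h1 := active i hij (by simpa [hij] using hi) U hU hne
      linarith
  · intro v hv p hp
    rw [sum_update_sdiff (PartStatus.load p)]
    simp only [mem_partIn, Finset.mem_sdiff] at hv
    rcases eq_or_ne (π v) j with hj | hj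
    · subst hj
      have hd : d = some p := by simpa using hp
      have hvM : v ∉ M := by tauto
      have h1 := retired_self p hd v (by simp [mem_partIn, hv.1, hvM])
      rw [if_neg hvM, hd]
      simpa [PartStatus.load] using h1
    · have h1 := retired v hv.1 hj p (by simpa [hj] using hp)
      rw [sum_erase_partIn (PartStatus.load p)]
      linarith

theorem partIn_mono (π : V → ι) {A B : Finset V} (h : A ⊆ B) (i : ι) :
    partIn π A i ⊆ partIn π B i := Finset.filter_subset_filter _ h

theorem exists_rank_gt (D : ι → PartStatus) : ∃ B : ℤ, ∀ i p, D i = some p → p.2 < B := by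
  obtain ⟨B, hB⟩ := (Finset.univ.image fun i => ((D i).map Prod.snd).getD 0).bddAbove
  refine ⟨B + 1, fun i p hi => ?_⟩
  have := hB (by simp :
    ((D i).map Prod.snd).getD 0 ∈ (Finset.univ.image fun i => ((D i).map Prod.snd).getD 0 : Set ℤ))
  rw [hi] at this
  simp at this
  omega

theorem exists_rank_lt (D : ι → PartStatus) : ∃ B : ℤ, ∀ i p, D i = some p → B < p.2 := by
  obtain ⟨B, hB⟩ := exists_rank_gt (fun i => (D i).map (Prod.map id (- ·)))
  refine ⟨-B, fun i p hi => ?_⟩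
  have := hB i _ (by rw [hi]; rfl)
  simp at this
  omega

/-- `U` is a marked subset of the active part `i` on which the demand is met with equality. -/
def IsTightIn (π : V → ι) (A : Finset V) (b : V → ℤ) (D : ι → PartStatus) (M : Finset V)
    (i : ι) (U : Finset V) : Prop :=
  D i = none ∧ U ⊆ partIn π M i ∧ U.Nonempty ∧
    ∑ v ∈ U, b v + allowance U.card (partIn π A i).card = demand π A D U.card

/-- If the demand is not tight on `U`, then it stays met when it drops by the number of marked
vertices of `U`, except that one unit is spared when all of `U` is marked. -/
theorem Inv.demand_add_card_inter_le {N : ℕ} {π : V → ι} {A : Finset V} {b : V → ℤ}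
    {D : ι → PartStatus} (h : Inv N π A b D) {M : Finset V} {i : ι} (hi : D i = none)
    {U : Finset V} (hU : U ⊆ partIn π A i) (hne : U.Nonempty)
    (hnt : ¬ IsTightIn π A b D M i U) {x : ℕ} (hx : (partIn π M i).card ≤ x) :
    demand π A D U.card + (U ∩ M).card - min ((U.card : ℤ) - 1) x ≤
      ∑ v ∈ U, b v + allowance U.card (partIn π A i).card := by
  have h1 := h.active i hi U hU hne
  have hsub : U ∩ M ⊆ partIn π M i := by
    intro v hv
    rw [Finset.mem_inter] at hv
    exact mem_partIn.2 ⟨hv.2, (mem_partIn.1 (hU hv.1)).2⟩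
  have h2 := Finset.card_le_card hsub
  by_cases hUM : U ⊆ M
  · have h3 : U ∩ M = U := Finset.inter_eq_left.2 hUM
    rw [h3] at h2 hsub ⊢
    have : ∑ v ∈ U, b v + allowance U.card (partIn π A i).card ≠ demand π A D U.card :=
      fun he => hnt ⟨hi, hsub, hne, he⟩
    omega
  · have h3 : (U ∩ M).card < U.card := by
      apply Finset.card_lt_card
      rw [Finset.ssubset_iff_subset_ne]
      exact ⟨Finset.inter_subset_left, fun he => hUM (Finset.inter_eq_left.1 he)⟩
    omega

/-- Links the two kinds of demand: passing from `t`-sets to `(t + 1)`-sets costs exactly the load on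
a part retired with type `t` behind all present ranks. A retired part contributes to the difference
only if its type is at least `t`, that is, if it has precedence. -/
theorem PartStatus.weight_succ {t : ℕ} (ht : 1 ≤ t) {B : ℤ} {d : PartStatus}
    (hd : ∀ p, d = some p → p.2 < B) (q : ℕ) :
    d.weight (t + 1) q = d.weight t q + d.load (t, B) q := by
  rcases d with _ | p
  · exact partWeight_succ ht q
  · have hp := hd p rfl
    simp only [PartStatus.weight, PartStatus.load]
    split_ifs with hc
    · rw [min_eq_left (by omega), min_eq_left (by omega)]
      push_cast
      ring
    · rw [min_eq_right (by omega), min_eq_right (by omega)]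
      ring

/-! ### Bob's three kinds of move -/

/-- Bob colors the marked vertices of the active part that contains a largest tight set, and retires
this part with the size of that set as its type. -/
theorem Inv.exists_of_isTightIn {N : ℕ} {π : V → ι} {A : Finset V} {b : V → ℤ}
    {D : ι → PartStatus} (h : Inv N π A b D) {M : Finset V} (hM : M ⊆ A)
    (ht : ∃ i U, IsTightIn π A b D M i U) :
    ∃ j D', Inv N π (A \ partIn π M j) (fun v => b v - if v ∈ M then 1 else 0) D' := by
  classical
  obtain ⟨i₀, U₀, hU₀⟩ := ht
  obtain ⟨U, hUmem, hmax⟩ := (M.powerset.filter fun U => ∃ i, IsTightIn π A b D M i U).exists_max_image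
    Finset.card ⟨U₀, by
      simp only [Finset.mem_filter, Finset.mem_powerset]
      exact ⟨hU₀.2.1.trans (Finset.filter_subset _ _), i₀, hU₀⟩⟩
  simp only [Finset.mem_filter, Finset.mem_powerset] at hUmem hmax
  obtain ⟨-, j, hj, hUj, hUne, hUeq⟩ := hUmem
  obtain ⟨B, hB⟩ := exists_rank_gt D
  have ht1 : 1 ≤ U.card := hUne.card_pos
  have htx : U.card ≤ (partIn π M j).card := Finset.card_le_card hUj
  have hxq := card_partIn_sdiff π hM j
  have hq2 := h.two_le j hj
  refine ⟨j, _, h.update j (some (U.card, B)) (by simp) ?_ ?_ ?_ (by simp) ?_ ?_⟩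
  · rintro p hp
    cases hp
    exact htx.trans ((by omega : _ ≤ (partIn π A j).card).trans (h.card_le j))
  · rintro p hp i - hi
    cases hp
    exact absurd (hB i _ hi) (lt_irrefl _)
  · intro i hij hi W hW hWne
    have hs1 : 1 ≤ W.card := hWne.card_pos
    rw [hj]
    simp only [PartStatus.weight_none, PartStatus.weight_some]
    have hq : (((partIn π (A \ M) j).card : ℕ) : ℤ) =
      (partIn π A j).card - (partIn π M j).card := by omega
    rw [hq]
    by_cases hst : W.card ≤ U.card
    · have h1 := le_partWeight_sub_of_le hs1 hst htx (by omega : _ ≤ (partIn π A j).card)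
      have h2 := h.active i hi W hW hWne
      have h3 : (W ∩ M).card ≤ W.card := Finset.card_le_card Finset.inter_subset_left
      zify at h3
      linarith
    · have h1 := le_partWeight_sub_of_lt ht1 (not_le.1 hst) htx (by omega) hq2
      have h2 := h.demand_add_card_inter_le (M := M) hi hW hWne
        (fun hc => hst (hmax W ⟨hc.2.1.trans (Finset.filter_subset _ _), i, hc⟩)) le_rfl
      have h3 := min_le_left ((W.card : ℤ) - 1) ((partIn π M i).card : ℤ)
      linarith
  · intro v hv hvj p hp
    have h1 := h.retired v hv p hp
    have h2 := hB _ _ hp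
    rw [hj]
    simp only [PartStatus.load_none, PartStatus.load_some]
    -- If the new part has precedence over `p`, then `p.1 < U.card` and at least `U.card` vertices
    -- were colored, so the load drops by at least one; otherwise it drops to zero from at least
    -- one.
    split_ifs <;> omega
  · rintro p hp v hv
    cases hp
    rw [mem_partIn, Finset.mem_sdiff] at hv
    have hvU : v ∉ U := fun hvU => hv.1.2 (mem_partIn.1 (hUj hvU)).1
    -- Subtracting the tight equality for `U` from the demand on `insert v U` isolates the budget of
    -- `v`.
    have h1 := h.active j hj (insert v U) (by
      intro w hw
      rcases Finset.mem_insert.1 hw with rfl | hw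
      · exact mem_partIn.2 ⟨hv.1.1, hv.2⟩
      · exact partIn_mono π hM j (hUj hw)) (Finset.insert_nonempty _ _)
    rw [Finset.card_insert_of_notMem hvU, Finset.sum_insert hvU] at h1
    have h2 : demand π A D (U.card + 1) = demand π A D U.card +
        ∑ i, (D i).load (U.card, B) (partIn π A i).card := by
      rw [demand, demand, ← Finset.sum_add_distrib]
      exact Finset.sum_congr rfl fun i _ => PartStatus.weight_succ ht1 (hB i) _
    rw [sum_erase_partIn (PartStatus.load _), hj]
    have h3 : 0 < (partIn π (A \ M) j).card :=
      Finset.card_pos.2 ⟨v, by simp [mem_partIn, hv.1, hv.2]⟩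
    simp only [PartStatus.load_none, allowance] at *
    push_cast at *
    -- The allowance grows by one only if `U.card ≤ q - 2`, and then the load `q - U.card` of the
    -- part itself, now removed, is at least two.
    omega

/-- Bob colors the marked vertices of the retired part that has precedence among those with a marked
vertex. -/
theorem Inv.exists_of_retired {N : ℕ} {π : V → ι} {A : Finset V} {b : V → ℤ}
    {D : ι → PartStatus} (h : Inv N π A b D) {M : Finset V} (hM : M ⊆ A)
    (hnt : ∀ i U, ¬ IsTightIn π A b D M i U) {x : ℕ}
    (hx : ∀ i, D i = none → (partIn π M i).card ≤ x)
    (hret : ∃ v ∈ M, ∃ p, D (π v) = some p ∧ x ≤ p.1) :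
    ∃ j D', Inv N π (A \ partIn π M j) (fun v => b v - if v ∈ M then 1 else 0) D' := by
  obtain ⟨u, hu, pu, hpu, hxu⟩ := hret
  obtain ⟨w, hw, hmin⟩ := (M.filter fun v => D (π v) ≠ none).exists_min_image
    -- The type is negated: precedence means highest type first, then lowest rank.
    (fun v => toLex (-(((D (π v)).getD (0, 0)).1 : ℤ), ((D (π v)).getD (0, 0)).2))
    ⟨u, by simp [hu, hpu]⟩
  simp only [Finset.mem_filter, Prod.Lex.le_iff, ofLex_toLex] at hw hmin
  obtain ⟨pw, hpw⟩ := Option.ne_none_iff_exists'.1 hw.2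
  have hmin' : ∀ v ∈ M, ∀ p, D (π v) = some p →
      p.1 < pw.1 ∨ p.1 = pw.1 ∧ pw.2 ≤ p.2 := by
    intro v hv p hp
    have := hmin v ⟨hv, by simp [hp]⟩
    simp only [hp, hpw, Option.getD_some] at this
    omega
  have hxw : x ≤ pw.1 := by
    have := hmin' u hu pu hpu
    omega
  have hcard := card_partIn_sdiff π hM (π w)
  have hpos : 0 < (partIn π M (π w)).card :=
    Finset.card_pos.2 ⟨w, mem_partIn.2 ⟨hw.1, rfl⟩⟩
  refine ⟨π w, _, h.update (π w) (D (π w)) (by simp [hpw]) (h.type_le _) ?_ ?_ (by simp [hpw]) ?_ ?_⟩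
  · intro p hp i hi hi'
    exact hi (h.inj _ _ p hi' hp)
  · intro i hij hi W hW hWne
    have h1 := h.demand_add_card_inter_le (M := M) hi hW hWne (hnt i W) (hx i hi)
    have hs1 : 1 ≤ W.card := hWne.card_pos
    rw [hpw]
    simp only [PartStatus.weight_some]
    have h2 : min ((W.card : ℤ) - 1) x ≤ min ((W.card : ℤ) - 1) pw.1 := by omega
    have h3 : 0 ≤ min ((W.card : ℤ) - 1) (pw.1 : ℤ) := by omega
    have h4 : ((partIn π A (π w)).card : ℤ) =
      (partIn π (A \ M) (π w)).card + (partIn π M (π w)).card := by omega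
    have h5 : min ((W.card : ℤ) - 1) (pw.1 : ℤ) * 1 ≤
        min ((W.card : ℤ) - 1) (pw.1 : ℤ) * (partIn π M (π w)).card :=
      mul_le_mul_of_nonneg_left (by omega) h3
    rw [h4, mul_add]
    linarith
  · intro v hv hvw p hp
    have h1 := h.retired v hv p hp
    have hmono : (D (π w)).load p (partIn π (A \ M) (π w)).card ≤
        (D (π w)).load p (partIn π A (π w)).card := by
      rw [hpw]
      simp only [PartStatus.load_some]
      split_ifs <;> omega
    by_cases hvM : v ∈ M
    · have hle := hmin' v hvM p hp
      have hne : pw ≠ p := by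
        rintro rfl
        exact hvw (h.inj _ _ pw hp hpw)
      have hne' : ¬ (pw.1 = p.1 ∧ pw.2 = p.2) := fun hc => hne (Prod.ext hc.1 hc.2)
      rw [hpw]
      simp only [PartStatus.load_some]
      rw [if_pos (by omega), if_pos (by omega), if_pos hvM]
      omega
    · rw [if_neg hvM]
      linarith
  · intro p hp v hv
    rw [mem_partIn, Finset.mem_sdiff] at hv
    have h1 := h.retired v hv.1.1 p (by rw [hv.2, hp])
    rw [sum_erase_partIn (PartStatus.load p), hp]
    simpa [PartStatus.load] using h1

/-- Bob colors the marked vertices of an active part with the most marked vertices. -/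
theorem Inv.exists_of_active {N : ℕ} {π : V → ι} {A : Finset V} {b : V → ℤ}
    {D : ι → PartStatus} (h : Inv N π A b D) {M : Finset V} (hM : M ⊆ A)
    (hnt : ∀ i U, ¬ IsTightIn π A b D M i U) {j : ι} (hj : D j = none)
    (hx : ∀ i, D i = none → (partIn π M i).card ≤ (partIn π M j).card)
    (hpos : 0 < (partIn π M j).card)
    (hret : (partIn π M j).card < (partIn π A j).card → ∀ v ∈ M, ∀ p, D (π v) = some p →
      p.1 < (partIn π M j).card) :
    ∃ j D', Inv N π (A \ partIn π M j) (fun v => b v - if v ∈ M then 1 else 0) D' := by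
  have hcard := card_partIn_sdiff π hM j
  have hq2 := h.two_le j hj
  have hqN := h.card_le j
  have hact : ∀ d : PartStatus, (∀ s, 1 ≤ s → d.weight s (partIn π (A \ M) j).card +
      min ((s : ℤ) - 1) (partIn π M j).card ≤ partWeight s (partIn π A j).card) →
      ∀ i ≠ j, D i = none → ∀ U ⊆ partIn π A i, U.Nonempty →
        demand π A D U.card + d.weight U.card (partIn π (A \ M) j).card ≤
          (D j).weight U.card (partIn π A j).card + ∑ v ∈ U, b v - (U ∩ M).card +
            allowance U.card (partIn π A i).card := by
    intro d hd i hij hi U hU hne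
    have h1 := h.demand_add_card_inter_le (M := M) hi hU hne (hnt i U) (hx i hi)
    have h2 := hd U.card hne.card_pos
    rw [hj]
    simp only [PartStatus.weight_none] at *
    linarith
  obtain ⟨B, hB⟩ := exists_rank_gt D
  obtain ⟨B', hB'⟩ := exists_rank_lt D
  rcases (by omega : (partIn π (A \ M) j).card = 0 ∨ (partIn π (A \ M) j).card = 1 ∨
    2 ≤ (partIn π (A \ M) j).card) with h0 | h1 | h2
  -- An emptied part contributes nothing, so type `0` is harmless.
  · refine ⟨j, _, h.update j (some (0, B)) (by simp) (by simp) ?_ (hact _ ?_) (by simp) ?_ ?_⟩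
    · rintro p hp i - hi
      cases hp
      exact absurd (hB i _ hi) (lt_irrefl _)
    · intro s hs
      rw [h0]
      simp only [PartStatus.weight_some]
      rcases hs.eq_or_lt with rfl | hs'
      · simp [partWeight_one]
      · have := add_le_partWeight hs' hq2
        push_cast
        omega
    · intro v hv hvj p hp
      have h1 := h.retired v hv p hp
      rw [hj, h0]
      simp only [PartStatus.load_none, PartStatus.load_some]
      split_ifs <;> omega
    · intro p hp v hv
      rw [Finset.card_eq_zero.1 h0] at hv
      simp at hv
  -- A single remaining vertex gets precedence over every retired part: the maximal type and a rank
  -- below all others. Its load is then only the number of other active parts, which the demand on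
  -- singletons covers.
  · refine ⟨j, _, h.update j (some (N, B')) (by simp) (by simp) ?_ (hact _ ?_) (by simp) ?_ ?_⟩
    · rintro p hp i - hi
      cases hp
      exact absurd (hB' i _ hi) (lt_irrefl _)
    · intro s hs
      rw [h1]
      simp only [PartStatus.weight_some]
      rcases hs.eq_or_lt with rfl | hs'
      · simp [partWeight_one]
      · have := add_le_partWeight hs' hq2
        push_cast
        omega
    · intro v hv hvj p hp
      have h3 := h.retired v hv p hp
      have h4 := hret (by omega) v
      have h5 := hB' _ _ hp
      rw [hj, h1]
      simp only [PartStatus.load_none, PartStatus.load_some]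
      split_ifs with hc hvM hvM
      · have := h4 hvM p hp
        omega
      · omega
      · omega
      · omega
    · intro p hp v hv
      cases hp
      rw [mem_partIn, Finset.mem_sdiff] at hv
      have h3 := h.active j hj {v} (by simp [mem_partIn, hv.1, hv.2]) (Finset.singleton_nonempty v)
      rw [Finset.card_singleton, Finset.sum_singleton, demand] at h3
      have h4 : ∑ i, (D i).load (N, B') (partIn π A i).card ≤
          ∑ i, (D i).weight 1 (partIn π A i).card := by
        apply Finset.sum_le_sum
        intro i _
        have hN := h.card_le i
        rcases hi : D i with _ | p
        · simp only [PartStatus.load_none, PartStatus.weight_none, partWeight_one]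
          omega
        · have hp := hB' i p hi
          simp only [PartStatus.load_some, PartStatus.weight_some]
          have hpN := h.type_le i p hi
          rw [if_neg (by omega)]
          simp
      rw [sum_erase_partIn (PartStatus.load _), hj]
      simp only [PartStatus.load_none, allowance] at *
      push_cast at *
      omega
  · refine ⟨j, _, h.update j none (fun _ => h2) (by simp) (by simp) (hact _ ?_) ?_ ?_ (by simp)⟩
    · intro s hs
      simp only [PartStatus.weight_none]
      rcases hs.eq_or_lt with rfl | hs'
      · simp [partWeight_one]
      · have := add_le_partWeight_add hs' h2 (partIn π M j).card
        rw [hcard] at this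
        omega
    · intro _ U hU hne
      have h3 := h.active j hj U (hU.trans (partIn_mono π Finset.sdiff_subset j)) hne
      have h4 := add_mul_le_partWeight_add hne.card_pos (Finset.card_le_card hU)
        (partIn π M j).card
      rw [hcard] at h4
      rw [hj]
      simp only [PartStatus.weight_none]
      have hU1 := hne.card_pos
      -- The allowance may shrink by up to `U.card - 1` as the part gets smaller; the drop in the
      -- part's own weight compensates.
      have h5 : ((U.card : ℤ) - 1) * 1 ≤ ((U.card : ℤ) - 1) * (partIn π M j).card :=
        mul_le_mul_of_nonneg_left (by omega) (by omega)
      have h6 : allowance U.card (partIn π A j).card ≤ (U.card : ℤ) - 1 := min_le_left _ _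
      have h7 : 0 ≤ allowance U.card (partIn π (A \ M) j).card := by
        rw [allowance]
        omega
      linarith
    · intro v hv hvj p hp
      have h3 := h.retired v hv p hp
      have h4 := hret (by omega) v
      rw [hj]
      simp only [PartStatus.load_none]
      split_ifs with hvM
      · have := h4 hvM p hp
        omega
      · omega

theorem Inv.pos {N : ℕ} {π : V → ι} {A : Finset V} {b : V → ℤ} {D : ι → PartStatus}
    (h : Inv N π A b D) {v : V} (hv : v ∈ A) : 0 < b v := by
  rcases hd : D (π v) with _ | p
  · have h1 := h.active (π v) hd {v} (by simp [mem_partIn, hv]) (Finset.singleton_nonempty v)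
    have h2 := h.two_le (π v) hd
    have h3 : (1 : ℤ) ≤ demand π A D 1 := by
      have h4 : ∀ i ∈ Finset.univ, 0 ≤ (D i).weight 1 (partIn π A i).card := by
        intro i _
        rcases D i with _ | p
        · simp [PartStatus.weight_none, partWeight_one]
        · simp [PartStatus.weight_some]
      have h5 := Finset.single_le_sum h4 (Finset.mem_univ (π v))
      rwa [hd, PartStatus.weight_none, partWeight_one] at h5
    rw [Finset.card_singleton, Finset.sum_singleton, allowance] at h1
    omega
  · have h1 := h.retired v hv p hd
    have h2 : 0 ≤ ∑ i, (D i).load p (partIn π A i).card := by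
      apply Finset.sum_nonneg
      intro i _
      rcases D i with _ | p'
      · rw [PartStatus.load_none]
        omega
      · rw [PartStatus.load_some]
        split_ifs <;> omega
    omega

theorem Inv.exists_step {N : ℕ} {π : V → ι} {A : Finset V} {b : V → ℤ} {D : ι → PartStatus}
    (h : Inv N π A b D) {M : Finset V} (hM : M ⊆ A) (hne : M.Nonempty) :
    ∃ j D', Inv N π (A \ partIn π M j) (fun v => b v - if v ∈ M then 1 else 0) D' := by
  classical
  by_cases ht : ∃ i U, IsTightIn π A b D M i U
  · exact h.exists_of_isTightIn hM ht
  have hnt : ∀ i U, ¬ IsTightIn π A b D M i U := fun i U hU => ht ⟨i, U, hU⟩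
  by_cases hact : ∃ v ∈ M, D (π v) = none
  · obtain ⟨v, hvM, hv⟩ := hact
    obtain ⟨j, hj, hx⟩ := (Finset.univ.filter fun i => D i = none).exists_max_image
      (fun i => (partIn π M i).card) ⟨π v, by simpa using hv⟩
    simp only [Finset.mem_filter, Finset.mem_univ, true_and] at hj hx
    have hpos : 0 < (partIn π M j).card :=
      (Finset.card_pos.2 ⟨v, mem_partIn.2 ⟨hvM, rfl⟩⟩).trans_le (hx _ hv)
    by_cases hret : ∃ w ∈ M, ∃ p, D (π w) = some p ∧ (partIn π M j).card ≤ p.1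
    · exact h.exists_of_retired hM hnt hx hret
    · refine h.exists_of_active hM hnt hj hx hpos fun _ w hw p hp => ?_
      by_contra hc
      exact hret ⟨w, hw, p, hp, not_lt.1 hc⟩
  -- No active vertex is marked, so every type passes the comparison.
  · refine h.exists_of_retired hM hnt (x := 0) ?_ ?_
    · intro i hi
      rw [Nat.le_zero, Finset.card_eq_zero, Finset.eq_empty_iff_forall_notMem]
      intro v hv
      rw [mem_partIn] at hv
      exact hact ⟨v, hv.1, by rw [hv.2, hi]⟩
    · obtain ⟨v, hv⟩ := hne
      rcases hd : D (π v) with _ | p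
      · exact absurd ⟨v, hv, hd⟩ hact
      · exact ⟨v, hv, p, hd, Nat.zero_le _⟩

/-! ### The initial position and the constant -/

/-- The constant budgets that suffice on a complete multipartite graph with `k` parts of size
`m`. -/
theorem onlineChoosable_completeEquipartiteGraph {m k B : ℕ} (hm : 2 ≤ m)
    (hB : ∀ s, 1 ≤ s → s ≤ m → (k : ℤ) * partWeight s m ≤ s * B + allowance s m) :
    OnlineChoosable (SimpleGraph.completeEquipartiteGraph k m) (fun _ => B) := by
  refine onlineChoosable_of_invariant _ _ (fun A b => ∃ D, Inv m Prod.fst A b D) ?_ ?_ ?_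
  · rintro A b ⟨D, h⟩ v hv
    exact h.pos hv
  · rintro A b ⟨D, h⟩ M hM hne
    obtain ⟨j, D', h'⟩ := h.exists_step hM hne
    refine ⟨partIn Prod.fst M j, Finset.filter_subset _ _, ?_, D', h'⟩
    intro u hu v hv _
    rw [Finset.mem_coe, mem_partIn] at hu hv
    simp [hu.2, hv.2]
  · have hcard : ∀ i : Fin k,
        (partIn Prod.fst (Finset.univ : Finset (Fin k × Fin m)) i).card = m := by
      intro i
      have : partIn Prod.fst (Finset.univ : Finset (Fin k × Fin m)) i =
          {i} ×ˢ Finset.univ := by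
        ext ⟨a, c⟩
        simp [mem_partIn, eq_comm]
      simp [this]
    refine ⟨fun _ => none, fun i => (hcard i).le, fun i _ => (hcard i).symm ▸ hm, by simp,
      by simp, ?_, by simp⟩
    intro i _ U hU hne
    have h1 := hB U.card hne.card_pos ((Finset.card_le_card hU).trans (hcard i).le)
    simpa [demand, hcard, PartStatus.weight_none] using h1

/-- AM-GM, in the form `(s - √(2m - 2))² ≥ 0`. Integrality turns the strict bound by `s * (B + 1)`
into slack `s - 1`, which absorbs the rounding of `B`. -/
theorem mul_partWeight_le {m k B : ℕ} (hm : 3 ≤ m)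
    (hB : ((m : ℝ) + 1 / 2 - Real.sqrt (2 * (m : ℝ) - 2)) * k < B + 1) {s : ℕ} (hs : 1 ≤ s)
    (hsm : s ≤ m) : (k : ℤ) * partWeight s m ≤ s * B + (s - 1) := by
  have hm' : (3 : ℝ) ≤ m := by exact_mod_cast hm
  have hs' : (1 : ℝ) ≤ s := by exact_mod_cast hs
  have hr := Real.sq_sqrt (by linarith : 0 ≤ 2 * (m : ℝ) - 2)
  have hw : 2 * (partWeight s m : ℝ) = 2 * ((s : ℝ) - 1) * m + 2 - s * (s - 1) := by
    exact_mod_cast two_mul_partWeight_of_le hs hsm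
  have h1 : (partWeight s m : ℝ) ≤ s * ((m : ℝ) + 1 / 2 - Real.sqrt (2 * (m : ℝ) - 2)) := by
    nlinarith [sq_nonneg ((s : ℝ) - Real.sqrt (2 * (m : ℝ) - 2))]
  have h2 : (k : ℝ) * partWeight s m < s * B + s := by
    calc (k : ℝ) * partWeight s m
        ≤ k * (s * ((m : ℝ) + 1 / 2 - Real.sqrt (2 * (m : ℝ) - 2))) := by gcongr
      _ = s * (((m : ℝ) + 1 / 2 - Real.sqrt (2 * (m : ℝ) - 2)) * k) := by ring
      _ < s * (B + 1) := by gcongr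
      _ = s * B + s := by ring
  have h3 : (k : ℤ) * partWeight s m < s * B + s := by exact_mod_cast h2
  linarith

theorem onlineChoiceNumber_completeEquipartiteGraph_le {m : ℕ} (k : ℕ) (hm : 3 ≤ m) :
    (onlineChoiceNumber (SimpleGraph.completeEquipartiteGraph k m) : ℝ) ≤
      ((m : ℝ) + 1 / 2 - Real.sqrt (2 * (m : ℝ) - 2)) * (k : ℝ) := by
  have hm' : (3 : ℝ) ≤ m := by exact_mod_cast hm
  have hsqrt : Real.sqrt (2 * (m : ℝ) - 2) ≤ m := by
    rw [Real.sqrt_le_left (by linarith)]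
    nlinarith [sq_nonneg ((m : ℝ) - 1)]
  have h0 : 0 ≤ ((m : ℝ) + 1 / 2 - Real.sqrt (2 * (m : ℝ) - 2)) * k :=
    mul_nonneg (by linarith) (Nat.cast_nonneg k)
  have hlt := Nat.lt_floor_add_one (((m : ℝ) + 1 / 2 - Real.sqrt (2 * (m : ℝ) - 2)) * k)
  refine le_trans (Nat.cast_le.2 (Nat.sInf_le ?_)) (Nat.floor_le h0)
  apply onlineChoosable_completeEquipartiteGraph (by omega)
  intro s hs hsm
  rw [allowance]
  rcases hsm.lt_or_eq with hlt' | rfl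
  · rw [min_eq_left (by omega)]
    exact mul_partWeight_le hm hlt hs hsm
  -- At `s = m` the allowance is only `m - 2`. The last summand of `partWeight m m` is `1`, so the
  -- cases `m - 1` and `1` of the bound add up to it.
  · obtain ⟨s, rfl⟩ : ∃ t, s = t + 1 := ⟨s - 1, by omega⟩
    have h1 := mul_partWeight_le hm hlt le_rfl hs
    have h2 := mul_partWeight_le hm hlt (by omega : 1 ≤ s) (by omega)
    rw [partWeight_one] at h1
    rw [partWeight_succ (by omega), min_eq_right (by omega), max_eq_right (by push_cast; omega)]
    push_cast at *
    linarith

end OnlineColoring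

/-- `SimpleGraph.completeEquipartiteGraph k m` is the complete multipartite graph with `k` parts of
size `m`. -/
theorem mainTheorem5 :
    (∀ m k : ℕ, 3 ≤ m →
      (OnlineColoring.onlineChoiceNumber (SimpleGraph.completeEquipartiteGraph k m) : ℝ) ≤
        ((m : ℝ) + 1 / 2 - Real.sqrt (2 * (m : ℝ) - 2)) * (k : ℝ)) ∧
    (∀ k : ℕ,
      (OnlineColoring.onlineChoiceNumber (SimpleGraph.completeEquipartiteGraph k 3) : ℝ) ≤
        3 * (k : ℝ) / 2) := by
  refine ⟨fun m k hm => OnlineColoring.onlineChoiceNumber_completeEquipartiteGraph_le k hm,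
    fun k => (OnlineColoring.onlineChoiceNumber_completeEquipartiteGraph_le k le_rfl).trans_eq ?_⟩
  have h : Real.sqrt (2 * ((3 : ℕ) : ℝ) - 2) = 2 := by
    rw [show 2 * ((3 : ℕ) : ℝ) - 2 = 2 ^ 2 by norm_num]
    exact Real.sqrt_sq (by norm_num)
  rw [h]
  push_cast
  ring
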